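/- Consider $n$ points on a circle, labelled $1,\dots,n$ in cyclic order starting from a fixed root mark on the circle. Given a set partition of these points, a crossing is a pair of crossing chords $u_1u_2$ and $v_1v_2$ such that $u_1,u_2$ belong to one block of the partition and $v_1,v_2$ belong to another block; here two chords with four distinct endpoints cross if their endpoints alternate around the circle, and every unordered pair of chords is counted once (so two blocks cross as many times as there are such pairs of chords among them). For every integer $k\ge 1$, the number $p_k(n)$ of set partitions of the $n$ points with exactly $k$ crossings satisfies \[ p_k(n) = \frac{(2k-3)!!}{2^{6k-1}\, k!\; \Gamma\!\left(k-\tfrac12\right)}\; n^{k-\frac32}\, 4^n\,(1+o(1)) \qquad (n\to\infty), \] where $(2k-3)!! = (2k-3)(2k-5)\cdots 3\cdot 1$ and $(-1)!!=1$. -/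

import Mathlib

/-- The crossings of a partition `P` of `n` points on a circle, the points being labelled
`0, 1, ..., n - 1` in the order in which they follow the root.
A chord is written as the pair of its endpoints in increasing order.  Two chords cross when their
endpoints are pairwise distinct and alternate around the circle; every unordered pair of
crossing chords is listed exactly once, the first chord being the one with the smallest endpoint.
A crossing of `P` is a pair of crossing chords, one with both endpoints in a block `U` of `P` and
the other with both endpoints in a different block `V` of `P`. -/
def partitionCrossings {n : ℕ} (P : Finpartition (Finset.univ : Finset (Fin n))) :
    Finset ((Fin n × Fin n) × (Fin n × Fin n)) :=
  Finset.univ.filter fun c =>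
    (c.1.1 < c.2.1 ∧ c.2.1 < c.1.2 ∧ c.1.2 < c.2.2) ∧
      ∃ U ∈ P.parts, ∃ V ∈ P.parts, U ≠ V ∧ c.1.1 ∈ U ∧ c.1.2 ∈ U ∧ c.2.1 ∈ V ∧ c.2.2 ∈ V

/-- The number of partitions of `n` (rooted, that is, labelled) points on a circle that have exactly
`k` crossings, counted with multiplicity. -/
def partitionCount (k n : ℕ) : ℕ :=
  (Finset.univ.filter fun P : Finpartition (Finset.univ : Finset (Fin n)) =>
    (partitionCrossings P).card = k).card

/-!
Join two blocks of a partition whenever they cross and let `T` be the union of the blocks linked to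
the block of the first point. The blocks outside `T` do not cross it and cannot enclose one of its
points, so they split into independent partitions of the gaps between consecutive points of `T`.
With `A` the series of all partitions and `K` that of the connected ones, crossings being marked by
`q`, this is the functional equation `A(x) = K(x A(x))`, and Lagrange inversion turns it into
`(n + 1) [x ^ n] A = [x ^ n] K ^ (n + 1)`.

A connected partition without crossings has a single block, and one with `k ≥ 1` crossings has at
most `4 * k` points because each point is an endpoint of a crossing. Hence `K = 1 / (1 - x) + q E`
where the part of `E` free of `q` is `x ^ 4`, the contribution of the two crossing diagonals of four
points. In the binomial expansion of `K ^ (n + 1)` the coefficient of `q ^ k` receives the terms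
with `r ≤ k` factors `q E`. Each of them is of order `n ^ r` times a binomial coefficient of order
`4 ^ n / √n`, so only `r = k` matters, and that term is `(n + 1).choose k` times
`(2 * n - 5 * k).choose (n - k)`.
-/

section LagrangeInversion

open PowerSeries

variable {R : Type*} [CommRing R]

theorem coeff_subst_eq_sum {w : R⟦X⟧} (hw : constantCoeff w = 0) (F : R⟦X⟧) (n : ℕ) :
    coeff n (F.subst w) = ∑ m ∈ Finset.range (n + 1), coeff m F * coeff n (w ^ m) := by
  rw [coeff_subst' (HasSubst.of_constantCoeff_zero' hw)]
  refine finsum_eq_sum_of_support_subset _ fun m hm => ?_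
  by_contra hnm
  have hdvd : X ^ m ∣ w ^ m := pow_dvd_pow_of_dvd (X_dvd_iff.2 hw) m
  have hzero := X_pow_dvd_iff.1 hdvd n (by simpa using hnm)
  exact hm (smul_eq_zero_of_right _ hzero)

theorem constantCoeff_subst_eq {w : R⟦X⟧} (hw : constantCoeff w = 0) (F : R⟦X⟧) :
    constantCoeff (F.subst w) = constantCoeff F := by
  simpa using coeff_subst_eq_sum hw F 0

theorem coeff_succ_subst_X_mul_add_C {K w : R⟦X⟧} (hw : w = X * K.subst w) (G : R⟦X⟧) (r : R)
    (n : ℕ) : coeff (n + 1) ((X * G + C r).subst w) = coeff n ((K * G).subst w) := by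
  have hs : HasSubst w := HasSubst.of_constantCoeff_zero' (by rw [hw]; simp)
  have hXG : (X * G).subst w = X * (K * G).subst w := by
    rw [subst_mul hs, subst_X hs, subst_mul hs, ← mul_assoc, ← hw]
  have hC : (C r).subst w = C r := subst_C r
  rw [subst_add hs, hXG, hC, map_add, coeff_succ_X_mul, coeff_succ_C, add_zero]

theorem derivative_mul_mul_pow (G K : R⟦X⟧) (n : ℕ) :
    ((n : R⟦X⟧) + 1) * (d⁄dX R (K * G) * K ^ n) =
      d⁄dX R (G * K ^ (n + 1)) + n * (d⁄dX R G * K ^ (n + 1)) := by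
  simp only [Derivation.leibniz, Derivation.leibniz_pow, smul_eq_mul, nsmul_eq_mul,
    Nat.add_sub_cancel]
  push_cast
  ring

/-- The induction is on `n` for all `H` at once: if `H = X * G + C r` then the coefficient of `H(w)`
of index `n + 1` is that of `(K * G)(w)` of index `n`. -/
theorem succ_mul_coeff_succ_subst [IsAddTorsionFree R] {K w : R⟦X⟧} (hw : w = X * K.subst w)
    (H : R⟦X⟧) (n : ℕ) :
    ((n : R) + 1) * coeff (n + 1) (H.subst w) = coeff n (d⁄dX R H * K ^ (n + 1)) := by
  have hw0 : constantCoeff w = 0 := by rw [hw]; simp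
  induction n generalizing H with
  | zero =>
    obtain ⟨G, r, rfl⟩ : ∃ G r, H = X * G + C r := ⟨_, _, eq_X_mul_shift_add_const H⟩
    rw [coeff_succ_subst_X_mul_add_C hw, coeff_zero_eq_constantCoeff_apply,
      constantCoeff_subst_eq hw0]
    simp [mul_comm]
  | succ n ih =>
    obtain ⟨G, r, rfl⟩ : ∃ G r, H = X * G + C r := ⟨_, _, eq_X_mul_shift_add_const H⟩
    have hderiv : d⁄dX R (X * G + C r) = G + X * d⁄dX R G := by
      simp [Derivation.leibniz, add_comm]
    have hcoeff : coeff (n + 1) (d⁄dX R (X * G + C r) * K ^ (n + 1 + 1)) =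
        coeff (n + 1) (G * K ^ (n + 1 + 1)) + coeff n (d⁄dX R G * K ^ (n + 1 + 1)) := by
      rw [hderiv, add_mul, map_add, mul_assoc, coeff_succ_X_mul]
    have hproduct := congr_arg (coeff n) (derivative_mul_mul_pow G K (n + 1))
    rw [map_add, coeff_derivative, ← Nat.cast_succ, ← Nat.cast_succ, ← nsmul_eq_mul, ← nsmul_eq_mul,
      map_nsmul, map_nsmul, nsmul_eq_mul, nsmul_eq_mul, ← ih] at hproduct
    refine nsmul_right_injective n.succ_ne_zero ?_
    simp only [nsmul_eq_mul]
    rw [coeff_succ_subst_X_mul_add_C hw, hcoeff]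
    push_cast at hproduct ⊢
    linear_combination hproduct

end LagrangeInversion

section FinpartitionPart

variable {α β γ : Type*} [DecidableEq α] [DecidableEq β] {S T : Finset α}
  {P Q : Finpartition S} {x y z : α}

theorem mem_of_mem_part (h : y ∈ P.part x) : x ∈ S :=
  P.part_nonempty.1 ⟨y, h⟩

theorem mem_part_comm : y ∈ P.part x ↔ x ∈ P.part y := by
  simp only [Finpartition.mem_part_iff_exists, and_comm]

theorem part_eq_part_iff (hx : x ∈ S) : P.part x = P.part y ↔ y ∈ P.part x := by
  by_cases hy : y ∈ S
  · rw [P.mem_part_iff_part_eq_part hy hx, eq_comm]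
  · rw [P.part_eq_empty.2 hy, P.part_eq_empty]
    exact iff_of_false (not_not_intro hx) fun h => hy (P.part_subset x h)

theorem part_eq_part (h : y ∈ P.part x) : P.part x = P.part y :=
  (part_eq_part_iff (mem_of_mem_part h)).2 h

theorem finpartition_ext (h : ∀ x ∈ S, ∀ y ∈ S, y ∈ P.part x ↔ y ∈ Q.part x) : P = Q := by
  suffices hsub : ∀ {P Q : Finpartition S}, (∀ x ∈ S, ∀ y ∈ S, y ∈ P.part x ↔ y ∈ Q.part x) →
      P.parts ⊆ Q.parts from
    Finpartition.ext ((hsub h).antisymm (hsub fun x hx y hy => (h x hx y hy).symm))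
  intro P Q hPQ U hU
  obtain ⟨x, hx⟩ := P.nonempty_of_mem_parts hU
  have hxS : x ∈ S := P.subset hU hx
  have hpart : P.part x = Q.part x := Finset.ext fun y =>
    ⟨fun hy => (hPQ x hxS y (P.part_subset x hy)).1 hy,
      fun hy => (hPQ x hxS y (Q.part_subset x hy)).2 hy⟩
  rw [← P.part_eq_of_mem hU hx, hpart]
  exact Q.part_mem.2 hxS

open Classical in
/-- The partition of `S` into the fibres of `g`. Partitions are glued and transported by
writing them in this form. -/
noncomputable def fiberPartition (S : Finset α) (g : α → γ) : Finpartition S :=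
  Finpartition.ofSetSetoid (Setoid.ker g) S

theorem mem_part_fiberPartition {g : α → γ} :
    y ∈ (fiberPartition S g).part x ↔ x ∈ S ∧ y ∈ S ∧ g x = g y := by
  classical
  exact Finpartition.mem_part_ofSetSetoid_iff_rel S

theorem mem_part_restrict (hT : T ⊆ S) :
    y ∈ (P.restrict hT).part x ↔ x ∈ T ∧ y ∈ T ∧ y ∈ P.part x := by
  simp only [Finpartition.mem_part_iff_exists, Finpartition.restrict, Finset.mem_erase,
    Finset.mem_image, Finset.bot_eq_empty, Finset.inf_eq_inter]
  constructor
  · rintro ⟨_, ⟨-, U, hU, rfl⟩, hy, hx⟩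
    grind
  · rintro ⟨hx, hy, U, hU, hyU, hxU⟩
    exact ⟨U ∩ T, ⟨Finset.ne_empty_of_mem (Finset.mem_inter.2 ⟨hxU, hx⟩), U, hU, rfl⟩, by grind⟩

/-- The preimage under an embedding `f` of a partition of the image of `S`. -/
noncomputable def comapPartition (f : α ↪ β) (Q : Finpartition (S.map f)) : Finpartition S :=
  fiberPartition S fun x => Q.part (f x)

/-- The image of a partition of `S` under an embedding `f`. -/
noncomputable def mapPartition (f : α ↪ β) (P : Finpartition S) : Finpartition (S.map f) :=
  fiberPartition (S.map f) (Function.extend f P.part fun _ => ∅)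

theorem mem_part_comapPartition {f : α ↪ β} {Q : Finpartition (S.map f)} :
    y ∈ (comapPartition f Q).part x ↔ f y ∈ Q.part (f x) := by
  rw [comapPartition, mem_part_fiberPartition]
  constructor
  · rintro ⟨hx, -, hxy⟩
    exact (part_eq_part_iff (Finset.mem_map_of_mem f hx)).1 hxy
  · intro hxy
    exact ⟨(Finset.mem_map' f).1 (mem_of_mem_part hxy),
      (Finset.mem_map' f).1 (Q.part_subset _ hxy), part_eq_part hxy⟩

theorem mem_part_mapPartition {f : α ↪ β} :
    f y ∈ (mapPartition f P).part (f x) ↔ y ∈ P.part x := by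
  rw [mapPartition, mem_part_fiberPartition, Finset.mem_map', Finset.mem_map',
    f.injective.extend_apply, f.injective.extend_apply]
  exact ⟨fun ⟨hx, _, hxy⟩ => (part_eq_part_iff hx).1 hxy,
    fun hxy => ⟨mem_of_mem_part hxy, P.part_subset x hxy, part_eq_part hxy⟩⟩

theorem part_mapPartition {f : α ↪ β} : (mapPartition f P).part (f x) = (P.part x).map f := by
  ext z
  constructor
  · intro hz
    obtain ⟨y, -, rfl⟩ := Finset.mem_map.1 (Finpartition.part_subset _ _ hz)
    exact Finset.mem_map_of_mem f (mem_part_mapPartition.1 hz)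
  · intro hz
    obtain ⟨y, hy, rfl⟩ := Finset.mem_map.1 hz
    exact mem_part_mapPartition.2 hy

/-- Transport of partitions along an embedding `f`. -/
noncomputable def finpartitionMapEquiv (f : α ↪ β) (S : Finset α) :
    Finpartition S ≃ Finpartition (S.map f) where
  toFun := mapPartition f
  invFun := comapPartition f
  left_inv P := finpartition_ext fun x _ y _ => by
    rw [mem_part_comapPartition, mem_part_mapPartition]
  right_inv Q := finpartition_ext fun x hx y hy => by
    obtain ⟨x, -, rfl⟩ := Finset.mem_map.1 hx
    obtain ⟨y, -, rfl⟩ := Finset.mem_map.1 hy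
    rw [mem_part_mapPartition, mem_part_comapPartition]

/-- A set `T` of points is saturated for `P` when it is a union of blocks of `P`. -/
def IsSaturated (P : Finpartition S) (T : Finset α) : Prop :=
  ∀ x ∈ T, P.part x ⊆ T

theorem IsSaturated.mem_iff (hT : IsSaturated P T) (h : y ∈ P.part x) : x ∈ T ↔ y ∈ T :=
  ⟨fun hx => hT x hx h, fun hy => hT y hy (mem_part_comm.1 h)⟩

theorem IsSaturated.sdiff (hT : IsSaturated P T) : IsSaturated P (S \ T) := fun x hx _ hy =>
  Finset.mem_sdiff.2 ⟨P.part_subset x hy, fun hyT =>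
    (Finset.mem_sdiff.1 hx).2 ((hT.mem_iff hy).2 hyT)⟩

theorem IsSaturated.part_restrict (hT : IsSaturated P T) (hTS : T ⊆ S) (hx : x ∈ T) :
    (P.restrict hTS).part x = P.part x := by
  ext y
  rw [mem_part_restrict]
  exact ⟨fun h => h.2.2, fun h => ⟨hx, hT x hx h, h⟩⟩

/-- The partition of `S` whose blocks are those of a partition of `T` and those of a partition of
the complement of `T`. -/
noncomputable def gluePartition (Q : Finpartition T) (R : Finpartition (S \ T)) :
    Finpartition S :=
  fiberPartition S fun x => (Q.part x, R.part x)

theorem mem_part_gluePartition (hT : T ⊆ S) {Q : Finpartition T} {R : Finpartition (S \ T)} :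
    y ∈ (gluePartition Q R).part x ↔ y ∈ Q.part x ∨ y ∈ R.part x := by
  rw [gluePartition, mem_part_fiberPartition, Prod.mk.injEq]
  constructor
  · rintro ⟨hx, -, hQ, hR⟩
    by_cases hxT : x ∈ T
    · exact Or.inl ((part_eq_part_iff hxT).1 hQ)
    · exact Or.inr ((part_eq_part_iff (Finset.mem_sdiff.2 ⟨hx, hxT⟩)).1 hR)
  · have hne {x : α} (hx : x ∈ T) : R.part x = ∅ :=
      R.part_eq_empty.2 fun h => (Finset.mem_sdiff.1 h).2 hx
    have hne' {x : α} (hx : x ∈ S \ T) : Q.part x = ∅ :=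
      Q.part_eq_empty.2 (Finset.mem_sdiff.1 hx).2
    rintro (hQ | hR)
    · have hx := mem_of_mem_part hQ
      have hy := Q.part_subset x hQ
      exact ⟨hT hx, hT hy, part_eq_part hQ, by rw [hne hx, hne hy]⟩
    · have hx := mem_of_mem_part hR
      have hy := R.part_subset x hR
      exact ⟨Finset.sdiff_subset hx, Finset.sdiff_subset hy, by rw [hne' hx, hne' hy],
        part_eq_part hR⟩

/-- A partition of which `T` is a union of blocks is the same as a pair of partitions, of `T` and of
its complement. -/
noncomputable def saturatedEquiv (hT : T ⊆ S) :
    {P : Finpartition S // IsSaturated P T} ≃ Finpartition T × Finpartition (S \ T) where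
  toFun P := (P.1.restrict hT, P.1.restrict Finset.sdiff_subset)
  invFun Q := ⟨gluePartition Q.1 Q.2, fun x hx y hy => by
    rcases (mem_part_gluePartition hT).1 hy with h | h
    · exact Q.1.part_subset x h
    · exact absurd hx (Finset.mem_sdiff.1 (mem_of_mem_part h)).2⟩
  left_inv P := Subtype.ext <| finpartition_ext fun x hx y hy => by
    have := P.2.mem_iff (x := x) (y := y)
    rw [mem_part_gluePartition hT, mem_part_restrict, mem_part_restrict]
    grind
  right_inv Q := by
    refine Prod.ext (finpartition_ext fun x hx y hy => ?_) (finpartition_ext fun x hx y hy => ?_)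
    · rw [mem_part_restrict, mem_part_gluePartition hT, and_iff_right hx, and_iff_right hy,
        or_iff_left fun h => (Finset.mem_sdiff.1 (mem_of_mem_part h)).2 hx]
    · rw [mem_part_restrict, mem_part_gluePartition hT, and_iff_right hx, and_iff_right hy,
        or_iff_right fun h => (Finset.mem_sdiff.1 hx).2 (mem_of_mem_part h)]

end FinpartitionPart

section Crossings

variable {α : Type*} [LinearOrder α] {S T U : Finset α} {P : Finpartition S} {a b c d s x y : α}

/-- The crossings of a partition of an arbitrary finite set of points on a line, encoded as in
`partitionCrossings`. -/
def crossings (P : Finpartition S) : Finset ((α × α) × (α × α)) :=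
  {p ∈ (S ×ˢ S) ×ˢ (S ×ˢ S) | (p.1.1 < p.2.1 ∧ p.2.1 < p.1.2 ∧ p.1.2 < p.2.2) ∧
    p.1.2 ∈ P.part p.1.1 ∧ p.2.2 ∈ P.part p.2.1 ∧ p.2.1 ∉ P.part p.1.1}

theorem mem_crossings : ((a, c), (b, d)) ∈ crossings P ↔
    (a < b ∧ b < c ∧ c < d) ∧ c ∈ P.part a ∧ d ∈ P.part b ∧ b ∉ P.part a := by
  simp only [crossings, Finset.mem_filter, Finset.mem_product, and_iff_right_iff_imp]
  rintro ⟨-, hac, hbd, -⟩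
  exact ⟨⟨mem_of_mem_part hac, P.part_subset a hac⟩, mem_of_mem_part hbd, P.part_subset b hbd⟩

/-- A union of blocks of `P`, no one of which crosses a block outside. -/
def IsCrossingClosed (P : Finpartition S) (T : Finset α) : Prop :=
  IsSaturated P T ∧ ∀ p ∈ crossings P, p.1.1 ∈ T ↔ p.2.1 ∈ T

/-- The partition `P` is connected when its blocks form a single class of the equivalence relation
generated by crossing. -/
def CrossingConnected (P : Finpartition S) : Prop :=
  ∀ T ⊆ S, T.Nonempty → IsCrossingClosed P T → T = S

open Classical in
/-- The union of the blocks of `P` that are linked to the block of `s` by a chain of crossing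
blocks. -/
noncomputable def component (P : Finpartition S) (s : α) : Finset α :=
  {x ∈ S | ∀ T ⊆ S, IsCrossingClosed P T → s ∈ T → x ∈ T}

/-- No block of `P` has points on both sides of a point of `T`. -/
def RespectsGaps (T : Finset α) (P : Finpartition S) : Prop :=
  ∀ t ∈ T, ∀ x, ∀ y ∈ P.part x, x < t → y < t

theorem IsSaturated.isCrossingClosed (hT : IsSaturated P T)
    (hconvex : ∀ x ∈ T, ∀ z ∈ T, ∀ y ∈ S, x < y → y < z → y ∈ T) : IsCrossingClosed P T := by
  refine ⟨hT, ?_⟩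
  rintro ⟨⟨a, c⟩, b, d⟩ hp
  obtain ⟨⟨hab, hbc, hcd⟩, hac, hbd, -⟩ := mem_crossings.1 hp
  constructor
  · intro ha
    exact hconvex a ha c (hT a ha hac) b (mem_of_mem_part hbd) hab hbc
  · intro hb
    exact (hT.mem_iff hac).2 <|
      hconvex b hb d (hT b hb hbd) c (P.part_subset a hac) hbc hcd

theorem IsCrossingClosed.sdiff (hT : IsCrossingClosed P T) : IsCrossingClosed P (S \ T) := by
  refine ⟨hT.1.sdiff, ?_⟩
  rintro ⟨⟨a, c⟩, b, d⟩ hp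
  obtain ⟨-, hac, hbd, -⟩ := mem_crossings.1 hp
  simp only [Finset.mem_sdiff, mem_of_mem_part hac, mem_of_mem_part hbd, hT.2 _ hp]

theorem IsCrossingClosed.crossings_restrict (hT : IsCrossingClosed P T) (hTS : T ⊆ S) :
    crossings (P.restrict hTS) = {p ∈ crossings P | p.1.1 ∈ T} := by
  ext ⟨⟨a, c⟩, b, d⟩
  rw [Finset.mem_filter]
  constructor
  · intro hp
    obtain ⟨hlt, hac, hbd, hab⟩ := mem_crossings.1 hp
    have ha := mem_of_mem_part hac
    rw [hT.1.part_restrict hTS ha] at hac hab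
    rw [hT.1.part_restrict hTS (mem_of_mem_part hbd)] at hbd
    exact ⟨mem_crossings.2 ⟨hlt, hac, hbd, hab⟩, ha⟩
  · rintro ⟨hp, ha⟩
    rw [mem_crossings, hT.1.part_restrict hTS ha, hT.1.part_restrict hTS ((hT.2 _ hp).1 ha)]
    exact mem_crossings.1 hp

theorem IsCrossingClosed.card_crossings (hT : IsCrossingClosed P T) (hTS : T ⊆ S) :
    (crossings P).card = (crossings (P.restrict hTS)).card +
      (crossings (P.restrict (Finset.sdiff_subset (s := S) (t := T)))).card := by
  rw [hT.crossings_restrict hTS, hT.sdiff.crossings_restrict Finset.sdiff_subset,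
    ← Finset.card_filter_add_card_filter_not fun p => p.1.1 ∈ T]
  congr 2
  refine Finset.filter_congr fun p hp => ?_
  obtain ⟨⟨a, c⟩, b, d⟩ := p
  simp only [Finset.mem_sdiff, mem_of_mem_part (mem_crossings.1 hp).2.1, true_and]

theorem IsCrossingClosed.isCrossingClosed_restrict_iff (hT : IsCrossingClosed P T) (hTS : T ⊆ S)
    (hU : U ⊆ T) : IsCrossingClosed (P.restrict hTS) U ↔ IsCrossingClosed P U := by
  have hsat : IsSaturated (P.restrict hTS) U ↔ IsSaturated P U :=
    forall₂_congr fun x hx => by rw [hT.1.part_restrict hTS (hU hx)]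
  rw [IsCrossingClosed, IsCrossingClosed, hsat, hT.crossings_restrict hTS]
  refine and_congr_right fun _ => ⟨fun h p hp => ?_, fun h p hp => h p (Finset.mem_filter.1 hp).1⟩
  by_cases hpT : p.1.1 ∈ T
  · exact h p (Finset.mem_filter.2 ⟨hp, hpT⟩)
  · exact iff_of_false (fun h => hpT (hU h)) fun h => hpT ((hT.2 p hp).2 (hU h))

theorem mem_component :
    x ∈ component P s ↔ x ∈ S ∧ ∀ T ⊆ S, IsCrossingClosed P T → s ∈ T → x ∈ T := by
  classical
  exact Finset.mem_filter

theorem component_subset : component P s ⊆ S := fun _ hx =>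
  (mem_component.1 hx).1

theorem component_subset_of_isCrossingClosed (hTS : T ⊆ S) (hT : IsCrossingClosed P T)
    (hs : s ∈ T) : component P s ⊆ T := fun _ hx =>
  (mem_component.1 hx).2 T hTS hT hs

theorem isCrossingClosed_component : IsCrossingClosed P (component P s) := by
  refine ⟨fun x hx y hy => ?_, ?_⟩
  · exact mem_component.2 ⟨P.part_subset x hy,
      fun T hTS hT hs => hT.1 x (component_subset_of_isCrossingClosed hTS hT hs hx) hy⟩
  · rintro ⟨⟨a, c⟩, b, d⟩ hp
    obtain ⟨-, hac, hbd, -⟩ := mem_crossings.1 hp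
    simp only [mem_component, mem_of_mem_part hac, mem_of_mem_part hbd, true_and]
    exact forall₄_congr fun T _ hT _ => hT.2 _ hp

theorem crossingConnected_restrict_component (hs : s ∈ S) :
    CrossingConnected (P.restrict (component_subset (P := P) (s := s))) := by
  intro U hU hne hclosed
  rw [isCrossingClosed_component.isCrossingClosed_restrict_iff _ hU] at hclosed
  by_cases hsU : s ∈ U
  · exact hU.antisymm
      (component_subset_of_isCrossingClosed (hU.trans component_subset) hclosed hsU)
  · obtain ⟨x, hx⟩ := hne
    have hx' : x ∈ S \ U := component_subset_of_isCrossingClosed Finset.sdiff_subset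
      hclosed.sdiff (Finset.mem_sdiff.2 ⟨hs, hsU⟩) (hU hx)
    exact absurd hx (Finset.mem_sdiff.1 hx').2

theorem CrossingConnected.component_eq (hTS : T ⊆ S) (hT : IsCrossingClosed P T) (hs : s ∈ T)
    (hconn : CrossingConnected (P.restrict hTS)) : component P s = T :=
  have hsub := component_subset_of_isCrossingClosed hTS hT hs
  hconn _ hsub ⟨s, mem_component.2 ⟨hTS hs, fun _ _ _ h => h⟩⟩
    ((hT.isCrossingClosed_restrict_iff hTS hsub).2 isCrossingClosed_component)

theorem RespectsGaps.isCrossingClosed (hT : IsSaturated P T)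
    (hgaps : RespectsGaps T (P.restrict (Finset.sdiff_subset (s := S) (t := T)))) :
    IsCrossingClosed P T := by
  have hout {t x y : α} (ht : t ∈ T) (hxT : x ∉ T) (hxy : y ∈ P.part x) (hlt : x < t) : y < t := by
    have hx : x ∈ S \ T := Finset.mem_sdiff.2 ⟨mem_of_mem_part hxy, hxT⟩
    exact hgaps t ht x y (by rwa [hT.sdiff.part_restrict _ hx]) hlt
  refine ⟨hT, ?_⟩
  rintro ⟨⟨a, c⟩, b, d⟩ hp
  obtain ⟨⟨hab, hbc, hcd⟩, hac, hbd, -⟩ := mem_crossings.1 hp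
  constructor <;> refine fun hmem => by_contra fun hnot => ?_
  · exact (hout (hT a hmem hac) hnot hbd hbc).not_gt hcd
  · exact (hout hmem hnot hac hab).not_gt hbc

/-- If a block outside `T` had points `x < t < y` around `t ∈ T`, the points of `T` between `x` and
`y` would form a closed set omitting `s`. -/
theorem CrossingConnected.respectsGaps (hTS : T ⊆ S) (hT : IsCrossingClosed P T)
    (hconn : CrossingConnected (P.restrict hTS)) (hs : s ∈ T) (hmin : ∀ x ∈ S, s ≤ x) :
    RespectsGaps T (P.restrict (Finset.sdiff_subset (s := S) (t := T))) := by
  intro t ht x y hxy hxt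
  rw [mem_part_restrict, Finset.mem_sdiff, Finset.mem_sdiff] at hxy
  obtain ⟨⟨hxS, hxT⟩, ⟨-, hyT⟩, hxy⟩ := hxy
  by_contra! hty
  let U : Finset α := {u ∈ T | x < u ∧ u < y}
  have hUT : U ⊆ T := Finset.filter_subset _ _
  have hsat : IsSaturated (P.restrict hTS) U := by
    intro u hu v hv
    obtain ⟨huT, hxu, huy⟩ := Finset.mem_filter.1 hu
    rw [hT.1.part_restrict hTS huT] at hv
    have hvT := hT.1 u huT hv
    refine Finset.mem_filter.2 ⟨hvT, ?_, ?_⟩ <;> by_contra! hle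
    · have hp : ((v, u), (x, y)) ∈ crossings P := mem_crossings.2
        ⟨⟨hle.lt_of_ne fun h => hxT (h ▸ hvT), hxu, huy⟩, mem_part_comm.1 hv, hxy,
          fun h => hxT (hT.1 v hvT h)⟩
      exact hxT ((hT.2 _ hp).1 hvT)
    · have hp : ((x, y), (u, v)) ∈ crossings P := mem_crossings.2
        ⟨⟨hxu, huy, hle.lt_of_ne fun h => hyT (h ▸ hvT)⟩, hxy, hv,
          fun h => hxT ((hT.1.mem_iff h).2 huT)⟩
      exact hxT ((hT.2 _ hp).2 huT)
  have hclosed : IsCrossingClosed (P.restrict hTS) U :=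
    hsat.isCrossingClosed fun a ha c hc b hb hab hbc =>
      Finset.mem_filter.2 ⟨hb, (Finset.mem_filter.1 ha).2.1.trans hab,
        hbc.trans (Finset.mem_filter.1 hc).2.2⟩
  have htU : t ∈ U := Finset.mem_filter.2 ⟨ht, hxt, hty.lt_of_ne fun h => hyT (h ▸ ht)⟩
  have hsU : s ∈ U := hconn U hUT ⟨t, htU⟩ hclosed ▸ hs
  exact (hmin x hxS).not_gt (Finset.mem_filter.1 hsU).2.1

theorem component_eq_iff (hTS : T ⊆ S) (hs : s ∈ T) (hmin : ∀ x ∈ S, s ≤ x) :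
    component P s = T ↔ IsSaturated P T ∧ CrossingConnected (P.restrict hTS) ∧
      RespectsGaps T (P.restrict (Finset.sdiff_subset (s := S) (t := T))) := by
  constructor
  · rintro rfl
    have hclosed : IsCrossingClosed P (component P s) := isCrossingClosed_component
    exact ⟨hclosed.1, crossingConnected_restrict_component (hTS hs),
      (crossingConnected_restrict_component (hTS hs)).respectsGaps hTS hclosed hs hmin⟩
  · rintro ⟨hsat, hconn, hgaps⟩
    exact hconn.component_eq hTS (hgaps.isCrossingClosed hsat) hs

end Crossings

section CrossingPolynomials

open Polynomial

variable {α β : Type*} [LinearOrder α] [LinearOrder β] {S T R : Finset α} {s t : α}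

/-- The generating polynomial of the partitions of `S` by number of crossings. -/
noncomputable def crossingPoly (S : Finset α) : ℝ[X] :=
  ∑ P : Finpartition S, X ^ (crossings P).card

open Classical in
/-- The generating polynomial of the connected partitions of `S` by number of crossings. -/
noncomputable def connectedPoly (S : Finset α) : ℝ[X] :=
  ∑ P : Finpartition S with CrossingConnected P, X ^ (crossings P).card

open Classical in
/-- The generating polynomial by number of crossings of the partitions of `R` that split along the
gaps left by `T`. -/
noncomputable def gapPoly (T R : Finset α) : ℝ[X] :=
  ∑ P : Finpartition R with RespectsGaps T P, X ^ (crossings P).card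

open Classical in
theorem sum_isSaturated_eq_mul (hTS : T ⊆ S) (p : Finpartition T → Prop)
    (q : Finpartition (S \ T) → Prop)
    (hclosed : ∀ P : Finpartition S, IsSaturated P T →
      q (P.restrict Finset.sdiff_subset) → IsCrossingClosed P T) :
    ∑ P : Finpartition S with
        IsSaturated P T ∧ p (P.restrict hTS) ∧ q (P.restrict Finset.sdiff_subset),
      (X : ℝ[X]) ^ (crossings P).card =
    (∑ Q : Finpartition T with p Q, X ^ (crossings Q).card) *
      ∑ R : Finpartition (S \ T) with q R, X ^ (crossings R).card := by
  rw [Finset.sum_mul_sum, ← Finset.sum_product']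
  let e := saturatedEquiv hTS
  refine Finset.sum_bij' (fun P hP => e ⟨P, (Finset.mem_filter.1 hP).2.1⟩)
    (fun Q _ => (e.symm Q).1) (fun P hP => ?_) (fun Q hQ => ?_) (fun P hP => ?_)
    (fun Q _ => ?_) fun P hP => ?_
  · obtain ⟨-, -, hp, hq⟩ := Finset.mem_filter.1 hP
    exact Finset.mem_product.2 ⟨Finset.mem_filter.2 ⟨Finset.mem_univ _, hp⟩,
      Finset.mem_filter.2 ⟨Finset.mem_univ _, hq⟩⟩
  · obtain ⟨hp, hq⟩ := Finset.mem_product.1 hQ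
    rw [← e.apply_symm_apply Q] at hp hq
    exact Finset.mem_filter.2 ⟨Finset.mem_univ _, (e.symm Q).2, (Finset.mem_filter.1 hp).2,
      (Finset.mem_filter.1 hq).2⟩
  · rw [e.symm_apply_apply]
  · exact e.apply_symm_apply Q
  · obtain ⟨-, hsat, -, hq⟩ := Finset.mem_filter.1 hP
    rw [(hclosed P hsat hq).card_crossings hTS, pow_add]
    rfl

open Classical in
theorem crossingPoly_eq_sum (hs : s ∈ S) (hmin : ∀ x ∈ S, s ≤ x) :
    crossingPoly S = ∑ T ∈ S.powerset with s ∈ T, connectedPoly T * gapPoly T (S \ T) := by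
  have hmaps : ∀ P ∈ (Finset.univ : Finset (Finpartition S)),
      component P s ∈ S.powerset.filter (s ∈ ·) := fun P _ =>
    Finset.mem_filter.2 ⟨Finset.mem_powerset.2 component_subset,
      mem_component.2 ⟨hs, fun _ _ _ h => h⟩⟩
  rw [crossingPoly, ← Finset.sum_fiberwise_of_maps_to hmaps]
  refine Finset.sum_congr rfl fun T hT => ?_
  obtain ⟨hTS, hsT⟩ := Finset.mem_filter.1 hT
  rw [Finset.mem_powerset] at hTS
  rw [connectedPoly, gapPoly, ← sum_isSaturated_eq_mul hTS _ _ fun P hsat hgaps =>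
    hgaps.isCrossingClosed hsat]
  exact Finset.sum_congr (Finset.filter_congr fun P _ => component_eq_iff hTS hsT hmin)
    fun _ _ => rfl

theorem respectsGaps_insert_iff {P : Finpartition S} (hRS : R ⊆ S) (hT : ∀ x ∈ T, x < t)
    (hR : ∀ x ∈ R, x < t) (hSR : ∀ x ∈ S \ R, t < x) :
    RespectsGaps (insert t T) P ↔ IsSaturated P R ∧ RespectsGaps T (P.restrict hRS) := by
  have hmem {x : α} (hx : x ∈ S) (hxt : x < t) : x ∈ R :=
    by_contra fun hxR => (hSR x (Finset.mem_sdiff.2 ⟨hx, hxR⟩)).not_gt hxt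
  constructor
  · refine fun h => ⟨fun x hx y hy => ?_, fun u hu x y hy => ?_⟩
    · exact hmem (P.part_subset x hy) (h t (Finset.mem_insert_self t T) x y hy (hR x hx))
    · exact h u (Finset.mem_insert_of_mem hu) x y ((mem_part_restrict hRS).1 hy).2.2
  · rintro ⟨hsat, hgaps⟩ u hu x y hy hxu
    have hut : u ≤ t := by
      rcases Finset.mem_insert.1 hu with rfl | hu
      · exact le_rfl
      · exact (hT u hu).le
    have hxR := hmem (mem_of_mem_part hy) (hxu.trans_le hut)
    have hyR := hsat x hxR hy
    rcases Finset.mem_insert.1 hu with rfl | hu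
    · exact hR y hyR
    · exact hgaps u hu x y ((mem_part_restrict hRS).2 ⟨hxR, hyR, hy⟩) hxu

theorem gapPoly_insert (hRS : R ⊆ S) (hT : ∀ x ∈ T, x < t) (hR : ∀ x ∈ R, x < t)
    (hSR : ∀ x ∈ S \ R, t < x) :
    gapPoly (insert t T) S = gapPoly T R * crossingPoly (S \ R) := by
  classical
  have hclosed (P : Finpartition S) (hsat : IsSaturated P R) : IsCrossingClosed P R := by
    refine hsat.isCrossingClosed fun x _ z hz y hy _ hyz => by_contra fun hyR => ?_
    exact (hSR y (Finset.mem_sdiff.2 ⟨hy, hyR⟩)).not_gt (hyz.trans (hR z hz))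
  have hprod := sum_isSaturated_eq_mul hRS (RespectsGaps T) (fun _ => True)
    fun P hsat _ => hclosed P hsat
  simp only [and_true, Finset.filter_true] at hprod
  rw [gapPoly, gapPoly, crossingPoly, ← hprod]
  exact Finset.sum_congr
    (Finset.filter_congr fun P _ => respectsGaps_insert_iff hRS hT hR hSR) fun _ _ => rfl

section Transport

variable {P : Finpartition S} (f : α ↪o β)

theorem crossings_mapPartition : crossings (mapPartition f.toEmbedding P) =
    (crossings P).map
      ((f.toEmbedding.prodMap f.toEmbedding).prodMap (f.toEmbedding.prodMap f.toEmbedding)) := by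
  have hmem (a b c d : α) : ((f a, f c), (f b, f d)) ∈ crossings (mapPartition f.toEmbedding P) ↔
      ((a, c), (b, d)) ∈ crossings P := by
    have hpart (x y : α) : f y ∈ (mapPartition f.toEmbedding P).part (f x) ↔ y ∈ P.part x :=
      mem_part_mapPartition
    simp only [mem_crossings, f.lt_iff_lt, hpart]
  ext p
  rw [Finset.mem_map]
  constructor
  · intro hp
    obtain ⟨hp', -⟩ := Finset.mem_filter.1 hp
    simp only [Finset.mem_product, Finset.mem_map] at hp'
    obtain ⟨⟨⟨a, -, ha⟩, c, -, hc⟩, ⟨b, -, hb⟩, d, -, hd⟩ := hp'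
    obtain rfl : ((f a, f c), (f b, f d)) = p :=
      Prod.ext (Prod.ext ha hc) (Prod.ext hb hd)
    exact ⟨((a, c), (b, d)), (hmem a b c d).1 hp, rfl⟩
  · rintro ⟨⟨⟨a, c⟩, b, d⟩, hp, rfl⟩
    exact (hmem a b c d).2 hp

theorem isSaturated_mapPartition :
    IsSaturated (mapPartition f.toEmbedding P) (T.map f.toEmbedding) ↔ IsSaturated P T := by
  simp only [IsSaturated, Finset.forall_mem_map, part_mapPartition, Finset.map_subset_map]

theorem isCrossingClosed_mapPartition :
    IsCrossingClosed (mapPartition f.toEmbedding P) (T.map f.toEmbedding) ↔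
      IsCrossingClosed P T := by
  refine and_congr (isSaturated_mapPartition f) ?_
  rw [crossings_mapPartition, Finset.forall_mem_map]
  refine forall₂_congr fun p _ => iff_congr ?_ ?_ <;> exact Finset.mem_map' f.toEmbedding

theorem crossingConnected_mapPartition :
    CrossingConnected (mapPartition f.toEmbedding P) ↔ CrossingConnected P := by
  simp only [CrossingConnected, Finset.subset_map_iff]
  constructor
  · intro h T hTS hne hT
    exact Finset.map_injective f.toEmbedding <|
      h _ ⟨T, hTS, rfl⟩ (hne.map) ((isCrossingClosed_mapPartition f).2 hT)
  · rintro h _ ⟨T, hTS, rfl⟩ hne hT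
    rw [h T hTS (Finset.map_nonempty.1 hne) ((isCrossingClosed_mapPartition f).1 hT)]

variable (S) in
theorem crossingPoly_map : crossingPoly (S.map f.toEmbedding) = crossingPoly S := by
  rw [crossingPoly, crossingPoly, ← (finpartitionMapEquiv f.toEmbedding S).sum_comp]
  refine Finset.sum_congr rfl fun P _ => congr_arg _ ?_
  exact (congr_arg Finset.card (crossings_mapPartition f)).trans (Finset.card_map _)

variable (S) in
theorem connectedPoly_map : connectedPoly (S.map f.toEmbedding) = connectedPoly S := by
  classical
  rw [connectedPoly, connectedPoly, Finset.sum_filter, Finset.sum_filter,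
    ← (finpartitionMapEquiv f.toEmbedding S).sum_comp]
  refine Finset.sum_congr rfl fun P _ => ?_
  refine if_congr (crossingConnected_mapPartition f) (congr_arg _ ?_) rfl
  exact (congr_arg Finset.card (crossings_mapPartition f)).trans (Finset.card_map _)

end Transport

theorem crossingPoly_eq_of_card {n : ℕ} (h : S.card = n) :
    crossingPoly S = crossingPoly (Finset.univ : Finset (Fin n)) := by
  rw [← crossingPoly_map _ (S.orderEmbOfFin h), Finset.map_orderEmbOfFin_univ]

theorem connectedPoly_eq_of_card {n : ℕ} (h : S.card = n) :
    connectedPoly S = connectedPoly (Finset.univ : Finset (Fin n)) := by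
  rw [← connectedPoly_map _ (S.orderEmbOfFin h), Finset.map_orderEmbOfFin_univ]

end CrossingPolynomials

section RootedSubsets

/-- The subsets of `{0, …, n - 1}` of size `m` that contain `0` if `n` is positive. They are the
possible point sets of the component of the root. -/
def rootedSubsets (n m : ℕ) : Finset (Finset ℕ) :=
  {T ∈ (Finset.range n).powersetCard m | 0 < n → 0 ∈ T}

theorem mem_rootedSubsets {n m : ℕ} {T : Finset ℕ} :
    T ∈ rootedSubsets n m ↔ (T ⊆ Finset.range n ∧ T.card = m) ∧ (0 < n → 0 ∈ T) := by
  rw [rootedSubsets, Finset.mem_filter, Finset.mem_powersetCard]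

theorem lt_of_mem_rootedSubsets {n m x : ℕ} {T : Finset ℕ} (hT : T ∈ rootedSubsets n m)
    (hx : x ∈ T) : x < n :=
  Finset.mem_range.1 ((mem_rootedSubsets.1 hT).1.1 hx)

theorem insert_mem_rootedSubsets {n m t : ℕ} {T : Finset ℕ} (ht : t < n)
    (hT : T ∈ rootedSubsets t m) : insert t T ∈ rootedSubsets n (m + 1) := by
  have hlt (x) (hx : x ∈ T) := lt_of_mem_rootedSubsets hT hx
  obtain ⟨⟨-, hcard⟩, h0⟩ := mem_rootedSubsets.1 hT
  refine mem_rootedSubsets.2 ⟨⟨fun x hx => ?_, ?_⟩, fun _ => ?_⟩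
  · grind
  · rw [Finset.card_insert_of_notMem fun h => (hlt t h).false, hcard]
  · grind

theorem erase_max_mem_rootedSubsets {n m : ℕ} {T : Finset ℕ} (hT : T ∈ rootedSubsets n (m + 1))
    (hne : T.Nonempty) : T.erase (T.max' hne) ∈ rootedSubsets (T.max' hne) m := by
  obtain ⟨⟨-, hcard⟩, h0⟩ := mem_rootedSubsets.1 hT
  have hmax := T.max'_mem hne
  refine mem_rootedSubsets.2 ⟨⟨fun x hx => ?_, ?_⟩, fun hpos => ?_⟩
  · exact Finset.mem_range.2 (T.lt_max'_of_mem_erase_max' hne hx)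
  · rw [Finset.card_erase_of_mem hmax, hcard, Nat.add_sub_cancel]
  · exact Finset.mem_erase.2 ⟨hpos.ne, h0 (hpos.trans (lt_of_mem_rootedSubsets hT hmax))⟩

theorem sum_rootedSubsets_succ {M : Type*} [AddCommMonoid M] (n m : ℕ) (f : Finset ℕ → M) :
    ∑ T ∈ rootedSubsets n (m + 1), f T =
      ∑ t ∈ Finset.range n, ∑ T ∈ rootedSubsets t m, f (insert t T) := by
  have hne {T} (hT : T ∈ rootedSubsets n (m + 1)) : T.Nonempty :=
    Finset.card_pos.1 ((mem_rootedSubsets.1 hT).1.2 ▸ m.succ_pos)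
  rw [Finset.sum_sigma']
  refine Finset.sum_bij'
    (fun T hT => (⟨T.max' (hne hT), T.erase (T.max' (hne hT))⟩ : (_ : ℕ) × Finset ℕ))
    (fun p _ => insert p.1 p.2) (fun T hT => ?_) (fun p hp => ?_) (fun T hT => ?_)
    (fun p hp => ?_) fun T hT => ?_
  · exact Finset.mem_sigma.2 ⟨Finset.mem_range.2
      (lt_of_mem_rootedSubsets hT (T.max'_mem (hne hT))), erase_max_mem_rootedSubsets hT (hne hT)⟩
  · obtain ⟨ht, hT⟩ := Finset.mem_sigma.1 hp
    exact insert_mem_rootedSubsets (Finset.mem_range.1 ht) hT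
  · exact Finset.insert_erase (T.max'_mem (hne hT))
  · obtain ⟨t, T⟩ := p
    have hlt (x) (hx : x ∈ T) : x < t :=
      lt_of_mem_rootedSubsets (Finset.mem_sigma.1 hp).2 hx
    have hmax (h : (insert t T).Nonempty) : (insert t T).max' h = t :=
      (Finset.max'_eq_iff _ _ _).2 ⟨Finset.mem_insert_self t T, by grind⟩
    simp only [hmax, Finset.erase_insert fun h => (hlt t h).false]
  · rw [Finset.insert_erase (T.max'_mem (hne hT))]

end RootedSubsets

section FunctionalEquation

open PowerSeries

/-- The bivariate generating series of partitions of points on a circle, the coefficients being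
polynomials in the variable that marks crossings. -/
noncomputable def partitionSeries : (Polynomial ℝ)⟦X⟧ :=
  mk fun n => crossingPoly (Finset.univ : Finset (Fin n))

/-- The series of those partitions counted by `partitionSeries` that are connected. -/
noncomputable def connectedSeries : (Polynomial ℝ)⟦X⟧ :=
  mk fun n => connectedPoly (Finset.univ : Finset (Fin n))

open Classical in
theorem sum_finpartition_empty {α : Type*} [LinearOrder α]
    {p : Finpartition (∅ : Finset α) → Prop} (hp : ∀ P, p P) :
    ∑ P : Finpartition (∅ : Finset α) with p P,
      (Polynomial.X : Polynomial ℝ) ^ (crossings P).card = 1 := by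
  let : Unique (Finpartition (∅ : Finset α)) := inferInstanceAs (Unique (Finpartition ⊥))
  have hcard : (crossings (default : Finpartition (∅ : Finset α))).card = 0 := by
    simp [crossings]
  rw [Finset.filter_true_of_mem fun P _ => hp P, Fintype.sum_unique, hcard, pow_zero]

theorem connectedPoly_empty {α : Type*} [LinearOrder α] : connectedPoly (∅ : Finset α) = 1 :=
  sum_finpartition_empty fun _ _ hT _ _ => Finset.subset_empty.1 hT

theorem gapPoly_empty {α : Type*} [LinearOrder α] (T : Finset α) : gapPoly T ∅ = 1 :=
  sum_finpartition_empty fun P _ _ x y hy _ => absurd (P.part_subset x hy) (Finset.notMem_empty y)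

theorem gapPoly_empty_left {α : Type*} [LinearOrder α] (R : Finset α) :
    gapPoly ∅ R = crossingPoly R := by
  simp [gapPoly, crossingPoly, RespectsGaps]

theorem gapPoly_insert_of_mem_rootedSubsets {n m t : ℕ} {T : Finset ℕ} (ht : t < n)
    (hT : T ∈ rootedSubsets t m) :
    gapPoly (insert t T) (Finset.range n \ insert t T) =
      gapPoly T (Finset.range t \ T) * coeff (n - 1 - t) partitionSeries := by
  have hlt (x) (hx : x ∈ T) := lt_of_mem_rootedSubsets hT hx
  have hsub : Finset.range t \ T ⊆ Finset.range n \ insert t T := by grind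
  have hdiff : (Finset.range n \ insert t T) \ (Finset.range t \ T) = Finset.Ioo t n := by grind
  rw [gapPoly_insert hsub hlt (by grind) (by grind), hdiff, partitionSeries, coeff_mk,
    crossingPoly_eq_of_card (Nat.card_Ioo t n), Nat.sub_right_comm]

theorem coeff_X_mul_partitionSeries_pow (n m : ℕ) :
    coeff n ((X * partitionSeries) ^ m) =
      ∑ T ∈ rootedSubsets n m, gapPoly T (Finset.range n \ T) := by
  induction m generalizing n with
  | zero =>
    rcases n with _ | n
    · have hroot : rootedSubsets 0 0 = {∅} := by decide
      rw [hroot, Finset.sum_singleton, Finset.range_zero, Finset.empty_sdiff, gapPoly_empty,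
        pow_zero, coeff_zero_one]
    · have hroot : rootedSubsets (n + 1) 0 = ∅ := by simp [rootedSubsets]
      rw [hroot, Finset.sum_empty, pow_zero, coeff_one, if_neg n.succ_ne_zero]
  | succ m ih =>
    rw [sum_rootedSubsets_succ]
    rcases n with _ | n
    · simp
    · rw [pow_succ, mul_left_comm, coeff_succ_X_mul, coeff_mul,
        Finset.Nat.sum_antidiagonal_eq_sum_range_succ_mk]
      refine Finset.sum_congr rfl fun t ht => ?_
      rw [ih, Finset.sum_mul]
      exact Finset.sum_congr rfl fun T hT =>
        (gapPoly_insert_of_mem_rootedSubsets (Finset.mem_range.1 ht) hT).symm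

theorem partitionSeries_eq_subst :
    partitionSeries = connectedSeries.subst (X * partitionSeries) := by
  classical
  ext1 n
  have hpartition : coeff n partitionSeries = crossingPoly (Finset.range n) := by
    rw [crossingPoly_eq_of_card (Finset.card_range n), partitionSeries, coeff_mk]
  have hconnected {m : ℕ} {T : Finset ℕ} (hT : T ∈ rootedSubsets n m) :
      coeff m connectedSeries = connectedPoly T := by
    rw [connectedPoly_eq_of_card (mem_rootedSubsets.1 hT).1.2, connectedSeries, coeff_mk]
  rw [coeff_subst_eq_sum (by simp), hpartition]
  simp only [coeff_X_mul_partitionSeries_pow, Finset.mul_sum]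
  rcases n.eq_zero_or_pos with rfl | hn
  · have hroot : rootedSubsets 0 0 = {∅} := by decide
    have h0 : ∅ ∈ rootedSubsets 0 0 := by decide
    simp [hroot, hconnected h0, connectedPoly_empty, gapPoly_empty_left]
  · rw [crossingPoly_eq_sum (s := 0) (Finset.mem_range.2 hn) fun x _ => x.zero_le]
    have hcard : ∀ T ∈ (Finset.range n).powerset.filter (0 ∈ ·),
        T.card ∈ Finset.range (n + 1) := fun T hT =>
      Finset.mem_range_succ_iff.2 <| (Finset.card_range n).subst <|
        Finset.card_le_card (Finset.mem_powerset.1 (Finset.mem_filter.1 hT).1)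
    rw [← Finset.sum_fiberwise_of_maps_to hcard]
    refine Finset.sum_congr rfl fun m _ => Finset.sum_congr ?_ fun T hT => ?_
    · ext T
      simp only [mem_rootedSubsets, Finset.mem_filter, Finset.mem_powerset, hn, forall_const]
      tauto
    · rw [hconnected hT]

end FunctionalEquation

section ConnectedPartitions

variable {α : Type*} [LinearOrder α] {S : Finset α} {P : Finpartition S} {x : α}
  {p : (α × α) × (α × α)}

theorem CrossingConnected.part_eq (hP : CrossingConnected P) (hx : x ∈ S)
    (hcross : ∀ p ∈ crossings P, x ∉ P.part p.1.1 ∧ x ∉ P.part p.2.1) : P.part x = S := by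
  refine hP _ (P.part_subset x) ⟨x, P.mem_part_self.2 hx⟩ ⟨fun y hy => ?_, fun p hp => ?_⟩
  · rw [part_eq_part hy]
  · exact iff_of_false (fun h => (hcross p hp).1 (mem_part_comm.1 h))
      fun h => (hcross p hp).2 (mem_part_comm.1 h)

theorem crossings_fiberPartition_const :
    crossings (fiberPartition S fun _ => ()) = ∅ := by
  refine Finset.eq_empty_of_forall_notMem ?_
  rintro ⟨⟨a, c⟩, b, d⟩ hp
  obtain ⟨-, hac, hbd, hab⟩ := mem_crossings.1 hp
  exact hab (mem_part_fiberPartition.2 ⟨mem_of_mem_part hac, mem_of_mem_part hbd, rfl⟩)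

theorem crossingConnected_and_crossings_eq_empty_iff :
    CrossingConnected P ∧ crossings P = ∅ ↔ P = fiberPartition S fun _ => () := by
  constructor
  · rintro ⟨hP, hcross⟩
    refine finpartition_ext fun x hx y hy => ?_
    have hpart : P.part x = S := hP.part_eq hx (by simp [hcross])
    rw [hpart, mem_part_fiberPartition]
    exact ⟨fun _ => ⟨hx, hy, rfl⟩, fun h => h.2.1⟩
  · rintro rfl
    refine ⟨fun T hTS ⟨x, hx⟩ hT => hTS.antisymm fun y hy => ?_, crossings_fiberPartition_const⟩
    exact hT.1 x hx (mem_part_fiberPartition.2 ⟨hTS hx, hy, rfl⟩)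

/-- The four endpoints of a pair of chords. -/
def crossingPoints (p : (α × α) × (α × α)) : Finset α :=
  {p.1.1, p.1.2, p.2.1, p.2.2}

theorem mem_crossingPoints {a b c d : α} :
    x ∈ crossingPoints ((a, c), (b, d)) ↔ x = a ∨ x = c ∨ x = b ∨ x = d := by
  simp only [crossingPoints, Finset.mem_insert, Finset.mem_singleton]

theorem card_crossingPoints (hp : p ∈ crossings P) : (crossingPoints p).card = 4 := by
  obtain ⟨⟨a, c⟩, b, d⟩ := p
  obtain ⟨⟨hab, hbc, hcd⟩, -⟩ := mem_crossings.1 hp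
  have hac := hab.trans hbc
  have hbd := hbc.trans hcd
  rw [crossingPoints, Finset.card_insert_of_notMem, Finset.card_insert_of_notMem,
    Finset.card_pair hbd.ne]
  · simp [hbc.ne', hcd.ne]
  · simp [hab.ne, hac.ne, (hac.trans hcd).ne]

theorem mem_crossings_iff_part_eq {a b c d : α} (ha : a ∈ S) (hb : b ∈ S) :
    ((a, c), (b, d)) ∈ crossings P ↔ (a < b ∧ b < c ∧ c < d) ∧
      P.part a = P.part c ∧ P.part b = P.part d ∧ P.part a ≠ P.part b := by
  rw [mem_crossings, ne_eq, part_eq_part_iff ha, part_eq_part_iff ha, part_eq_part_iff hb]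

theorem exists_mem_crossingPoints_of_mem_part (hp : p ∈ crossings P)
    (hx : x ∈ P.part p.1.1 ∨ x ∈ P.part p.2.1) : ∃ q ∈ crossings P, x ∈ crossingPoints q := by
  obtain ⟨⟨a, c⟩, b, d⟩ := p
  have haS := mem_of_mem_part (mem_crossings.1 hp).2.1
  have hbS := mem_of_mem_part (mem_crossings.1 hp).2.2.1
  have hcS := P.part_subset a (mem_crossings.1 hp).2.1
  obtain ⟨⟨hab, hbc, hcd⟩, hac, hbd, hnot⟩ := (mem_crossings_iff_part_eq haS hbS).1 hp
  have hxS : x ∈ S := hx.elim (fun h => P.part_subset a h) fun h => P.part_subset b h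
  dsimp only at hx
  rw [← part_eq_part_iff haS, ← part_eq_part_iff hbS] at hx
  -- Among the chords from `x` into its block, one crosses the chord of the other block.
  rcases hx with hx | hx
  · rcases lt_trichotomy x b with hxb | rfl | hxb
    · refine ⟨((x, c), (b, d)),
        (mem_crossings_iff_part_eq hxS hbS).2 ⟨⟨hxb, hbc, hcd⟩, by grind, hbd, by grind⟩, ?_⟩
      exact mem_crossingPoints.2 (by tauto)
    · exact absurd hx hnot
    rcases lt_trichotomy x d with hxd | rfl | hxd
    · refine ⟨((a, x), (b, d)),
        (mem_crossings_iff_part_eq haS hbS).2 ⟨⟨hab, hxb, hxd⟩, hx, hbd, hnot⟩, ?_⟩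
      exact mem_crossingPoints.2 (by tauto)
    · exact absurd (hx.trans hbd.symm) hnot
    · refine ⟨((b, d), (c, x)),
        (mem_crossings_iff_part_eq hbS hcS).2 ⟨⟨hbc, hcd, hxd⟩, hbd, by grind, by grind⟩, ?_⟩
      exact mem_crossingPoints.2 (by tauto)
  · rcases lt_trichotomy x a with hxa | rfl | hxa
    · refine ⟨((x, b), (a, c)),
        (mem_crossings_iff_part_eq hxS haS).2 ⟨⟨hxa, hab, hbc⟩, hx.symm, hac, by grind⟩, ?_⟩
      exact mem_crossingPoints.2 (by tauto)
    · exact absurd hx.symm hnot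
    rcases lt_trichotomy x c with hxc | rfl | hxc
    · refine ⟨((a, c), (x, d)),
        (mem_crossings_iff_part_eq haS hxS).2 ⟨⟨hxa, hxc, hcd⟩, hac, by grind, by grind⟩, ?_⟩
      exact mem_crossingPoints.2 (by tauto)
    · exact absurd (hac.trans hx.symm) hnot
    · refine ⟨((a, c), (b, x)),
        (mem_crossings_iff_part_eq haS hbS).2 ⟨⟨hab, hbc, hxc⟩, hac, hx, hnot⟩, ?_⟩
      exact mem_crossingPoints.2 (by tauto)

theorem CrossingConnected.exists_mem_crossingPoints (hP : CrossingConnected P)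
    (hcross : (crossings P).Nonempty) (hx : x ∈ S) :
    ∃ q ∈ crossings P, x ∈ crossingPoints q := by
  by_contra! hnone
  have hpart : P.part x = S := hP.part_eq hx fun p hp => not_or.1 fun h => by
    obtain ⟨q, hq, hxq⟩ := exists_mem_crossingPoints_of_mem_part hp h
    exact hnone q hq hxq
  obtain ⟨⟨⟨a, c⟩, b, d⟩, hp⟩ := hcross
  have ha := mem_of_mem_part (mem_crossings.1 hp).2.1
  obtain ⟨q, hq, hxq⟩ := exists_mem_crossingPoints_of_mem_part hp
    (Or.inl (mem_part_comm.1 (hpart ▸ ha)))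
  exact hnone q hq hxq

theorem CrossingConnected.eq_biUnion_crossingPoints (hP : CrossingConnected P)
    (hcross : (crossings P).Nonempty) : S = (crossings P).biUnion crossingPoints := by
  ext x
  rw [Finset.mem_biUnion]
  refine ⟨hP.exists_mem_crossingPoints hcross, ?_⟩
  rintro ⟨⟨⟨a, c⟩, b, d⟩, hp, hx⟩
  obtain ⟨-, hac, hbd, -⟩ := mem_crossings.1 hp
  rcases mem_crossingPoints.1 hx with rfl | rfl | rfl | rfl
  · exact mem_of_mem_part hac
  · exact P.part_subset a hac
  · exact mem_of_mem_part hbd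
  · exact P.part_subset b hbd

theorem CrossingConnected.card_le (hP : CrossingConnected P) (hcross : (crossings P).Nonempty) :
    S.card ≤ (crossings P).card * 4 := by
  conv_lhs => rw [hP.eq_biUnion_crossingPoints hcross]
  exact Finset.card_biUnion_le_card_mul _ _ _ fun p hp => (card_crossingPoints hp).le

theorem CrossingConnected.card_eq_four (hP : CrossingConnected P)
    (hcross : (crossings P).card = 1) : S.card = 4 := by
  obtain ⟨p, hp⟩ := Finset.card_eq_one.1 hcross
  have hmem : p ∈ crossings P := hp ▸ Finset.mem_singleton_self p
  rw [hP.eq_biUnion_crossingPoints ⟨p, hmem⟩, hp, Finset.singleton_biUnion,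
    card_crossingPoints hmem]

/-- The partition of four points on a circle into its two crossing diagonals. -/
noncomputable def diagonalsPartition : Finpartition (Finset.univ : Finset (Fin 4)) :=
  fiberPartition Finset.univ fun x => x.val % 2

theorem mem_part_diagonalsPartition {x y : Fin 4} :
    y ∈ diagonalsPartition.part x ↔ x.val % 2 = y.val % 2 := by
  rw [diagonalsPartition, mem_part_fiberPartition]
  simp only [Finset.mem_univ, true_and]

theorem crossings_diagonalsPartition : crossings diagonalsPartition = {((0, 2), (1, 3))} := by
  ext ⟨⟨a, c⟩, b, d⟩
  rw [mem_crossings, mem_part_diagonalsPartition, mem_part_diagonalsPartition,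
    mem_part_diagonalsPartition, Finset.mem_singleton]
  revert a b c d
  decide

theorem crossingConnected_diagonalsPartition : CrossingConnected diagonalsPartition := by
  rintro T - ⟨x, hx⟩ ⟨hsat, hcross⟩
  have hblock {x y : Fin 4} (h : x.val % 2 = y.val % 2) : x ∈ T ↔ y ∈ T :=
    hsat.mem_iff (mem_part_diagonalsPartition.2 h)
  have h01 : (0 : Fin 4) ∈ T ↔ 1 ∈ T :=
    hcross ((0, 2), (1, 3)) (crossings_diagonalsPartition ▸ Finset.mem_singleton_self _)
  have h02 : (0 : Fin 4) ∈ T ↔ 2 ∈ T := hblock rfl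
  have h13 : (1 : Fin 4) ∈ T ↔ 3 ∈ T := hblock rfl
  have h0 : (0 : Fin 4) ∈ T := by
    fin_cases x <;> simp_all
  ext y
  fin_cases y <;> simp_all

theorem eq_diagonalsPartition {P : Finpartition (Finset.univ : Finset (Fin 4))}
    (hcross : (crossings P).Nonempty) : P = diagonalsPartition := by
  obtain ⟨⟨⟨a, c⟩, b, d⟩, hp⟩ := hcross
  obtain ⟨⟨hab, hbc, hcd⟩, hac, hbd, hnot⟩ :=
    (mem_crossings_iff_part_eq (Finset.mem_univ a) (Finset.mem_univ b)).1 hp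
  obtain ⟨rfl, rfl, rfl, rfl⟩ : a = 0 ∧ b = 1 ∧ c = 2 ∧ d = 3 := by omega
  refine finpartition_ext fun x _ y _ => ?_
  rw [mem_part_diagonalsPartition, ← part_eq_part_iff (Finset.mem_univ x)]
  fin_cases x <;> fin_cases y <;> simp [← hac, ← hbd, hnot, Ne.symm hnot]

end ConnectedPartitions

section CountingPolynomials

open Polynomial

theorem coeff_sum_X_pow {R ι : Type*} [Semiring R] (s : Finset ι) (f : ι → ℕ) (k : ℕ) :
    (∑ i ∈ s, (X : R[X]) ^ f i).coeff k = ((s.filter fun i => f i = k).card : R) := by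
  simp only [finsetSum_coeff, coeff_X_pow, Finset.sum_boole, eq_comm]

theorem crossings_eq_partitionCrossings {n : ℕ}
    (P : Finpartition (Finset.univ : Finset (Fin n))) : crossings P = partitionCrossings P := by
  ext ⟨⟨a, c⟩, b, d⟩
  rw [mem_crossings, partitionCrossings, Finset.mem_filter, and_iff_right (Finset.mem_univ _)]
  refine and_congr_right fun _ => ?_
  constructor
  · rintro ⟨hac, hbd, hab⟩
    have ha : P.part a ∈ P.parts := P.part_mem.2 (Finset.mem_univ a)
    have hb : P.part b ∈ P.parts := P.part_mem.2 (Finset.mem_univ b)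
    have hb_self : b ∈ P.part b := P.mem_part_self.2 (Finset.mem_univ b)
    exact ⟨_, ha, _, hb, fun h => hab (h ▸ hb_self), P.mem_part_self.2 (Finset.mem_univ a), hac,
      hb_self, hbd⟩
  · rintro ⟨U, hU, V, hV, hUV, haU, hcU, hbV, hdV⟩
    dsimp only at haU hcU hbV hdV
    rw [P.part_eq_of_mem hU haU, P.part_eq_of_mem hV hbV]
    exact ⟨hcU, hdV, fun hbU => hUV (P.eq_of_mem_parts hU hV hbU hbV)⟩

theorem coeff_crossingPoly (k n : ℕ) :
    (crossingPoly (Finset.univ : Finset (Fin n))).coeff k = partitionCount k n := by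
  simp only [crossingPoly, coeff_sum_X_pow, crossings_eq_partitionCrossings, partitionCount]

theorem coeff_zero_connectedPoly {α : Type*} [LinearOrder α] (S : Finset α) :
    (connectedPoly S).coeff 0 = 1 := by
  classical
  rw [connectedPoly, coeff_sum_X_pow, Nat.cast_eq_one, Finset.card_eq_one, Finset.filter_filter]
  refine ⟨fiberPartition S fun _ => (), Finset.ext fun P => ?_⟩
  rw [Finset.mem_filter, and_iff_right (Finset.mem_univ P), Finset.card_eq_zero,
    crossingConnected_and_crossings_eq_empty_iff, Finset.mem_singleton]

theorem coeff_connectedPoly_eq_zero {α : Type*} [LinearOrder α] {S : Finset α} {j : ℕ}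
    (hj : j ≠ 0) (hS : 4 * j < S.card) : (connectedPoly S).coeff j = 0 := by
  classical
  rw [connectedPoly, coeff_sum_X_pow, Nat.cast_eq_zero, Finset.card_eq_zero, Finset.filter_filter]
  refine Finset.filter_false_of_mem ?_
  rintro P - ⟨hP, rfl⟩
  exact (hP.card_le (Finset.card_ne_zero.1 hj)).not_gt (by omega)

theorem coeff_one_connectedPoly (n : ℕ) :
    (connectedPoly (Finset.univ : Finset (Fin n))).coeff 1 = if n = 4 then 1 else 0 := by
  classical
  rw [connectedPoly, coeff_sum_X_pow, Finset.filter_filter]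
  split_ifs with hn
  · subst hn
    rw [Nat.cast_eq_one, Finset.card_eq_one]
    refine ⟨diagonalsPartition, Finset.ext fun P => ?_⟩
    rw [Finset.mem_filter, and_iff_right (Finset.mem_univ P), Finset.mem_singleton]
    constructor
    · exact fun h => eq_diagonalsPartition (Finset.card_ne_zero.1 (by omega))
    · rintro rfl
      exact ⟨crossingConnected_diagonalsPartition, by
        rw [crossings_diagonalsPartition, Finset.card_singleton]⟩
  · rw [Nat.cast_eq_zero, Finset.card_eq_zero]
    refine Finset.filter_false_of_mem fun P _ h => hn ?_
    simpa using h.1.card_eq_four h.2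

end CountingPolynomials

section CoefficientExtraction

open PowerSeries

variable {R : Type*} [CommSemiring R]

theorem coeff_coeff_C_X_mul_add_pow (F G : (Polynomial R)⟦X⟧) (N n k : ℕ) :
    (coeff n ((C Polynomial.X * F + G) ^ N)).coeff k =
      ∑ r ∈ Finset.range (k + 1),
        (N.choose r : R) * (coeff n (F ^ r * G ^ (N - r))).coeff (k - r) := by
  have hterm (r : ℕ) : (coeff n ((C Polynomial.X * F) ^ r * G ^ (N - r) *
      (N.choose r : (Polynomial R)⟦X⟧))).coeff k =
      if r ≤ k then (N.choose r : R) * (coeff n (F ^ r * G ^ (N - r))).coeff (k - r) else 0 := by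
    rw [mul_comm _ (N.choose r : (Polynomial R)⟦X⟧), mul_pow, mul_assoc, ← map_pow,
      ← map_natCast (C (R := Polynomial R)), coeff_C_mul, coeff_C_mul, ← Polynomial.C_eq_natCast,
      Polynomial.coeff_C_mul, Polynomial.coeff_X_pow_mul', mul_ite, mul_zero]
  rw [add_pow, map_sum, Polynomial.finsetSum_coeff]
  simp only [hterm, ← Finset.sum_filter]
  refine Finset.sum_subset (fun r hr => ?_) fun r hr hr' => ?_
  · exact Finset.mem_range_succ_iff.2 (Finset.mem_filter.1 hr).2
  · have hNr : N < r := by grind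
    rw [Nat.choose_eq_zero_of_lt hNr, Nat.cast_zero, zero_mul]

theorem coeff_coeff_pow_eq_zero {F : (Polynomial R)⟦X⟧} {d : ℕ}
    (hF : ∀ i j, d * (j + 1) < i → (coeff i F).coeff j = 0) {r i j : ℕ} (h : d * (j + r) < i) :
    (coeff i (F ^ r)).coeff j = 0 := by
  induction r generalizing i j with
  | zero => rw [pow_zero, coeff_one, if_neg (Nat.zero_lt_of_lt h).ne', Polynomial.coeff_zero]
  | succ r ih =>
    rw [pow_succ, coeff_mul, Polynomial.finsetSum_coeff]
    refine Finset.sum_eq_zero fun p hp => ?_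
    rw [Polynomial.coeff_mul]
    refine Finset.sum_eq_zero fun q hq => ?_
    rw [Finset.HasAntidiagonal.mem_antidiagonal] at hp hq
    by_cases hlt : d * (q.1 + r) < p.1
    · rw [ih hlt, zero_mul]
    · rw [hF p.2 q.2 (by subst hp hq; linarith), mul_zero]

/-- The series of connected partitions with at least one crossing, with one crossing left out of the
count. -/
noncomputable def crossedSeries : (Polynomial ℝ)⟦X⟧ :=
  mk fun n => (connectedPoly (Finset.univ : Finset (Fin n))).divX

theorem connectedSeries_eq : connectedSeries = C Polynomial.X * crossedSeries + mk 1 := by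
  ext1 n
  rw [connectedSeries, crossedSeries, coeff_mk, map_add, coeff_C_mul, coeff_mk, coeff_mk]
  conv_lhs => rw [← Polynomial.X_mul_divX_add (connectedPoly Finset.univ),
    coeff_zero_connectedPoly, Polynomial.C_1]
  rfl

theorem coeff_coeff_crossedSeries_pow_eq_zero {r i j : ℕ} (h : 4 * (j + r) < i) :
    (coeff i (crossedSeries ^ r)).coeff j = 0 := by
  refine coeff_coeff_pow_eq_zero (fun i j hij => ?_) h
  rw [crossedSeries, coeff_mk, Polynomial.coeff_divX]
  exact coeff_connectedPoly_eq_zero j.succ_ne_zero (by rwa [Finset.card_fin])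

theorem coeff_zero_coeff_crossedSeries_pow (r i : ℕ) :
    (coeff i (crossedSeries ^ r)).coeff 0 = if i = 4 * r then 1 else 0 := by
  have hmap : map Polynomial.constantCoeff crossedSeries = X ^ 4 := by
    ext i
    rw [coeff_map, Polynomial.constantCoeff_apply, crossedSeries, coeff_mk, Polynomial.coeff_divX,
      coeff_one_connectedPoly, coeff_X_pow]
  rw [← Polynomial.constantCoeff_apply, ← coeff_map, map_pow, hmap, ← pow_mul, coeff_X_pow]

theorem succ_mul_partitionCount_eq_coeff (k n : ℕ) :
    ((n : ℝ) + 1) * partitionCount k n = (coeff n (connectedSeries ^ (n + 1))).coeff k := by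
  have hw : X * partitionSeries = X * connectedSeries.subst (X * partitionSeries) := by
    rw [← partitionSeries_eq_subst]
  have hsubst : HasSubst (X * partitionSeries) := HasSubst.of_constantCoeff_zero' (by simp)
  have hpoly := succ_mul_coeff_succ_subst hw X n
  rw [subst_X hsubst, coeff_succ_X_mul, derivative_X, one_mul, partitionSeries, coeff_mk] at hpoly
  rw [← hpoly, ← coeff_crossingPoly, ← Nat.cast_succ, ← Nat.cast_succ, ← Polynomial.C_eq_natCast,
    Polynomial.coeff_C_mul]

theorem coeff_coeff_crossedSeries_pow_mul {k r n : ℕ} (hrk : r ≤ k) (hkn : 4 * k ≤ n) :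
    (coeff n (crossedSeries ^ r * mk 1 ^ (n + 1 - r))).coeff (k - r) =
      ∑ i ∈ Finset.range (4 * k + 1), (coeff i (crossedSeries ^ r)).coeff (k - r) *
        ((n - r + (n - i)).choose (n - r) : ℝ) := by
  have hexp : n + 1 - r = n - r + 1 := by omega
  rw [hexp, mk_one_pow_eq_mk_choose_add, coeff_mul, Polynomial.finsetSum_coeff,
    Finset.Nat.sum_antidiagonal_eq_sum_range_succ_mk]
  simp only [coeff_mk, ← Polynomial.C_eq_natCast, Polynomial.coeff_mul_C]
  refine (Finset.sum_subset (Finset.range_mono (Nat.succ_le_succ hkn)) fun i _ hi => ?_).symm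
  rw [coeff_coeff_crossedSeries_pow_eq_zero (by grind), zero_mul]

theorem succ_mul_partitionCount {k n : ℕ} (h : 4 * k ≤ n) :
    ((n : ℝ) + 1) * partitionCount k n =
      ∑ r ∈ Finset.range (k + 1), ((n + 1).choose r : ℝ) *
        ∑ i ∈ Finset.range (4 * k + 1), (coeff i (crossedSeries ^ r)).coeff (k - r) *
          ((n - r + (n - i)).choose (n - r) : ℝ) := by
  rw [succ_mul_partitionCount_eq_coeff, connectedSeries_eq, coeff_coeff_C_X_mul_add_pow]
  refine Finset.sum_congr rfl fun r hr => ?_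
  rw [coeff_coeff_crossedSeries_pow_mul (Finset.mem_range_succ_iff.1 hr) h]

end CoefficientExtraction

section Asymptotics

open Asymptotics Filter PowerSeries

theorem isEquivalent_centralBinom :
    (fun n : ℕ => (n.centralBinom : ℝ)) ~[atTop] fun n => 4 ^ n / √(Real.pi * n) := by
  have hstirling := Stirling.factorial_isEquivalent_stirling
  have hdouble := hstirling.comp_tendsto (tendsto_id.const_mul_atTop' two_pos)
  refine ((hdouble.div (hstirling.mul hstirling)).congr_left ?_).congr_right ?_
  · refine .of_forall fun n => ?_
    simp only [Pi.div_apply, Pi.mul_apply, Function.comp_apply, id_eq,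
      Nat.centralBinom_eq_two_mul_choose, two_mul, Nat.cast_add_choose]
  · filter_upwards [eventually_gt_atTop 0] with n hn
    have : (0 : ℝ) < n := Nat.cast_pos.2 hn
    have hsqrt (x : ℝ) : √(2 * x * Real.pi) = √2 * √(Real.pi * x) := by
      rw [← Real.sqrt_mul zero_le_two, mul_assoc, mul_comm x]
    have hsqrt_double : √(2 * ((2 * n : ℕ) : ℝ) * Real.pi) = 2 * √(Real.pi * n) := by
      rw [hsqrt, Nat.cast_mul, mul_left_comm, Nat.cast_ofNat, Real.sqrt_mul zero_le_two,
        ← mul_assoc, Real.mul_self_sqrt zero_le_two]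
    have hpow : (((2 * n : ℕ) : ℝ) / Real.exp 1) ^ (2 * n) =
        4 ^ n * ((n / Real.exp 1) ^ n * (n / Real.exp 1) ^ n) := by
      rw [← mul_pow, ← mul_pow, pow_mul]
      congr 1
      push_cast
      ring
    simp only [Pi.div_apply, Pi.mul_apply, Function.comp_apply, id_eq]
    rw [hsqrt_double, hsqrt, hpow]
    field_simp
    rw [Real.sq_sqrt zero_le_two]

theorem choose_sub_add_sub_eq {a b n : ℕ} (ha : a ≤ n) (hb : b ≤ n) :
    ((n - a + (n - b)).choose (n - a) : ℝ) =
      n.centralBinom * (n.descFactorial a * n.descFactorial b) /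
        (2 * n).descFactorial (a + b) := by
  have hsub : n - a + (n - b) = 2 * n - (a + b) := by omega
  have hfa := congr_arg (Nat.cast (R := ℝ)) (Nat.factorial_mul_descFactorial ha)
  have hfb := congr_arg (Nat.cast (R := ℝ)) (Nat.factorial_mul_descFactorial hb)
  have hf := congr_arg (Nat.cast (R := ℝ))
    (Nat.factorial_mul_descFactorial (show a + b ≤ 2 * n by omega))
  push_cast at hfa hfb hf
  have hdesc : ((2 * n).descFactorial (a + b) : ℝ) ≠ 0 :=
    Nat.cast_ne_zero.2 (Nat.descFactorial_pos.2 (by omega)).ne'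
  have hdesca : (n.descFactorial a : ℝ) ≠ 0 :=
    Nat.cast_ne_zero.2 (Nat.descFactorial_pos.2 ha).ne'
  have hdescb : (n.descFactorial b : ℝ) ≠ 0 :=
    Nat.cast_ne_zero.2 (Nat.descFactorial_pos.2 hb).ne'
  have hfac : (n.factorial : ℝ) * n.factorial =
      (n - a).factorial * n.descFactorial a * ((n - b).factorial * n.descFactorial b) := by
    rw [hfa, hfb]
  rw [Nat.cast_add_choose, hsub, Nat.centralBinom_eq_two_mul_choose,
    Nat.cast_choose ℝ (Nat.le_mul_of_pos_left n two_pos), two_mul, Nat.add_sub_cancel, ← two_mul,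
    ← hf, hfac]
  field_simp

theorem isEquivalent_choose_sub_add_sub (a b : ℕ) :
    (fun n : ℕ => ((n - a + (n - b)).choose (n - a) : ℝ)) ~[atTop]
      fun n => 4 ^ n / √(Real.pi * n) / 2 ^ (a + b) := by
  have hdouble := (isEquivalent_descFactorial (a + b)).comp_tendsto
    (tendsto_id.const_mul_atTop' two_pos)
  refine (((isEquivalent_centralBinom.mul ((isEquivalent_descFactorial a).mul
    (isEquivalent_descFactorial b))).div hdouble).congr_left ?_).congr_right ?_
  · filter_upwards [eventually_ge_atTop a, eventually_ge_atTop b] with n ha hb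
    exact (choose_sub_add_sub_eq ha hb).symm
  · filter_upwards [eventually_gt_atTop 0] with n hn
    have : (0 : ℝ) < n := Nat.cast_pos.2 hn
    simp only [Pi.div_apply, Pi.mul_apply, Function.comp_apply, id_eq]
    push_cast
    rw [mul_pow, pow_add (n : ℝ)]
    field_simp

theorem isBigO_choose_sub_add_sub (a b c : ℕ) :
    (fun n : ℕ => ((n - a + (n - b)).choose (n - a) : ℝ)) =O[atTop]
      fun n => 4 ^ n / √(Real.pi * n) / 2 ^ c := by
  refine (isEquivalent_choose_sub_add_sub a b).isBigO.trans ?_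
  simp only [div_eq_mul_inv _ ((2 : ℝ) ^ _), mul_comm _ ((2 : ℝ) ^ _)⁻¹]
  exact ((isBigO_refl _ _).const_mul_left _).const_mul_right (by positivity)

theorem isEquivalent_natCast_add_one : (fun n : ℕ => (n : ℝ) + 1) ~[atTop] fun n => (n : ℝ) :=
  IsEquivalent.refl.add_isLittleO (isLittleO_const_id_atTop 1).natCast_atTop

theorem isEquivalent_succ_choose (r : ℕ) :
    (fun n : ℕ => ((n + 1).choose r : ℝ)) ~[atTop] fun n => (n : ℝ) ^ r / r.factorial := by
  refine ((isEquivalent_choose r).comp_tendsto (tendsto_add_atTop_nat 1)).trans ?_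
  refine .div ?_ .refl
  refine (isEquivalent_natCast_add_one.pow r).congr_left (.of_forall fun n => ?_)
  simp

theorem isLittleO_succ_choose {r k : ℕ} (h : r < k) :
    (fun n : ℕ => ((n + 1).choose r : ℝ)) =o[atTop] fun n => (n : ℝ) ^ k / k.factorial := by
  refine (isEquivalent_succ_choose r).trans_isLittleO ?_
  simp only [div_eq_inv_mul]
  exact (((isLittleO_pow_pow_atTop_of_lt h).natCast_atTop).const_mul_left _).const_mul_right
    (inv_ne_zero (Nat.cast_ne_zero.2 k.factorial_ne_zero))

theorem isEquivalent_succ_mul_partitionCount (k : ℕ) :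
    (fun n : ℕ => ((n : ℝ) + 1) * partitionCount k n) ~[atTop]
      fun n => (n : ℝ) ^ k / k.factorial * (4 ^ n / √(Real.pi * n) / 2 ^ (5 * k)) := by
  have htop : (fun n : ℕ => ((n + 1).choose k : ℝ) * ∑ i ∈ Finset.range (4 * k + 1),
      (coeff i (crossedSeries ^ k)).coeff (k - k) * ((n - k + (n - i)).choose (n - k) : ℝ)) ~[atTop]
      fun n => (n : ℝ) ^ k / k.factorial * (4 ^ n / √(Real.pi * n) / 2 ^ (5 * k)) := by
    have hexp : k + 4 * k = 5 * k := by ring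
    have hchoose := isEquivalent_choose_sub_add_sub k (4 * k)
    rw [hexp] at hchoose
    refine ((isEquivalent_succ_choose k).mul hchoose).congr_left (.of_forall fun n => ?_)
    simp [coeff_zero_coeff_crossedSeries_pow]
  have hlower : (fun n : ℕ => ∑ r ∈ Finset.range k, ((n + 1).choose r : ℝ) *
      ∑ i ∈ Finset.range (4 * k + 1), (coeff i (crossedSeries ^ r)).coeff (k - r) *
        ((n - r + (n - i)).choose (n - r) : ℝ)) =o[atTop]
      fun n => (n : ℝ) ^ k / k.factorial * (4 ^ n / √(Real.pi * n) / 2 ^ (5 * k)) := by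
    exact IsLittleO.fun_sum fun r hr =>
      (isLittleO_succ_choose (Finset.mem_range.1 hr)).mul_isBigO
        (IsBigO.fun_sum fun i _ => (isBigO_choose_sub_add_sub r i (5 * k)).const_mul_left _)
  refine (htop.add_isLittleO hlower).congr_left ?_
  filter_upwards [eventually_ge_atTop (4 * k)] with n hn
  rw [succ_mul_partitionCount hn, Finset.sum_range_succ]
  exact add_comm _ _

theorem isEquivalent_partitionCount (k : ℕ) :
    (fun n : ℕ => (partitionCount k n : ℝ)) ~[atTop]
      fun n => 1 / (k.factorial * 2 ^ (5 * k) * √Real.pi) *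
        (n : ℝ) ^ ((k : ℝ) - 3 / 2) * 4 ^ n := by
  refine (((isEquivalent_succ_mul_partitionCount k).div
    isEquivalent_natCast_add_one).congr_left ?_).congr_right ?_
  · refine .of_forall fun n => ?_
    exact mul_div_cancel_left₀ _ n.cast_add_one_ne_zero
  · filter_upwards [eventually_gt_atTop 0] with n hn
    have hpos : (0 : ℝ) < n := Nat.cast_pos.2 hn
    have hrpow : (n : ℝ) ^ ((k : ℝ) - 3 / 2) = n ^ k / (n * √n) := by
      rw [Real.rpow_sub hpos, Real.rpow_natCast, Real.sqrt_eq_rpow,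
        ← Real.rpow_one_add' hpos.le (by norm_num)]
      norm_num
    rw [Pi.div_apply, hrpow, Real.sqrt_mul Real.pi_pos.le]
    field_simp

theorem doubleFactorial_div_Gamma {k : ℕ} (hk : 1 ≤ k) :
    ((Nat.doubleFactorial (2 * k - 3) : ℕ) : ℝ) /
        ((2 : ℝ) ^ (6 * k - 1) * (Nat.factorial k : ℝ) * Real.Gamma ((k : ℝ) - 1 / 2)) =
      1 / (k.factorial * 2 ^ (5 * k) * √Real.pi) := by
  obtain ⟨j, rfl⟩ := Nat.exists_eq_add_of_le' hk
  have harg : ((j + 1 : ℕ) : ℝ) - 1 / 2 = j + 1 / 2 := by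
    push_cast
    ring
  have hdouble : 2 * (j + 1) - 3 = 2 * j - 1 := by omega
  have hexp : 6 * (j + 1) - 1 = j + 5 * (j + 1) := by omega
  have hfac : ((Nat.doubleFactorial (2 * j - 1) : ℕ) : ℝ) ≠ 0 :=
    Nat.cast_ne_zero.2 (Nat.doubleFactorial_pos _).ne'
  rw [harg, hdouble, hexp, Real.Gamma_nat_add_half, pow_add]
  field_simp

end Asymptotics

/-- For `k = 1` the truncated subtraction gives `0‼ = 1`, which agrees with `(-1)!! = 1`. -/
theorem mainTheorem4 (k : ℕ) (hk : 1 ≤ k) :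
    Asymptotics.IsEquivalent Filter.atTop
      (fun n : ℕ => (partitionCount k n : ℝ))
      (fun n : ℕ =>
        ((Nat.doubleFactorial (2 * k - 3) : ℕ) : ℝ) /
            ((2 : ℝ) ^ (6 * k - 1) * (Nat.factorial k : ℝ) * Real.Gamma ((k : ℝ) - 1 / 2)) *
          (n : ℝ) ^ ((k : ℝ) - 3 / 2) * (4 : ℝ) ^ n) := by
  rw [doubleFactorial_div_Gamma hk]
  exact isEquivalent_partitionCount k
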